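/- Fix a constant $\rho_0\in(0,1)$. For each $n$, let $X=(X_1,\dots,X_n)$ be a Gaussian vector with $\mathbb{E}[X_i]=0$ and $\operatorname{var}(X_i)=1$ for all $1\le i\le n$, whose correlation matrix $R\in\mathbb{R}^{n\times n}$ satisfies $R_{ij}=\rho_0$ for all $i\neq j$. Let $M_n(X)=\max_{1\le i\le n}X_i$, and let $\operatorname{med}[M_n(X)]$ denote any median of $M_n(X)$. Then $$\lim_{n\to\infty}\ \frac{\operatorname{med}[M_n(X)]^2}{\operatorname{var}[M_n(X)]}\cdot\frac{1}{2\log(n)}\ =\ \frac{1-\rho_0}{\rho_0}.$$ -/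

import Mathlib

open MeasureTheory ProbabilityTheory Filter Topology

/-- The maximum `M_n(x) = max_{1 ≤ i ≤ n} x_i` of the coordinates of a vector (a supremum over the
finite index set, hence attained as soon as `1 ≤ n`). -/
noncomputable def maxCoord {n : ℕ} (x : Fin n → ℝ) : ℝ := ⨆ i, x i

/-- The correlation matrix of a random vector `X`, with entries
`cov(X_i, X_j) / (√var(X_i) √var(X_j))`. -/
noncomputable def corrMatrix {n : ℕ} {Ω : Type*} [MeasurableSpace Ω] (P : Measure Ω)
    (X : Ω → Fin n → ℝ) : Matrix (Fin n) (Fin n) ℝ :=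
  Matrix.of fun i j =>
    cov[fun ω => X ω i, fun ω => X ω j; P] /
      (√(Var[fun ω => X ω i; P]) * √(Var[fun ω => X ω j; P]))

/-- `m` is a median of the real random variable `Y`: both `P(Y ≤ m)` and `P(Y ≥ m)` are at
least `1/2`. -/
def IsMedian {Ω : Type*} [MeasurableSpace Ω] (P : Measure Ω) (Y : Ω → ℝ) (m : ℝ) : Prop :=
  1 / 2 ≤ P {ω | Y ω ≤ m} ∧ 1 / 2 ≤ P {ω | m ≤ Y ω}

/-! In law $X_i=\sqrt{\rho_0}\,Z+\sqrt{1-\rho_0}\,\xi_i$ with $Z,\xi_1,\dots,\xi_n$ independent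
standard Gaussians, so $M_n(X)=\sqrt{\rho_0}\,Z+\sqrt{1-\rho_0}\,M_n(\xi)$. Expanding the square
gives, for every $t$, the identity $E(M_n(X)-\sqrt{1-\rho_0}\,t)^2=\rho_0+(1-\rho_0)E(M_n(\xi)-t)^2$
(`integral_sub_sq_maxCoord`).

The analytic input is $E(M_n(\xi)-\sqrt{2\log n})^2\to0$ (`tendsto_integral_sub_sq_maxCoord`). The
variance therefore tends to $\rho_0$, the contribution of $Z$ alone, and by Markov's inequality any
median is $\sqrt{1-\rho_0}\sqrt{2\log n}+O(1)$. The limit of the ratio follows. -/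

/-- A Gaussian vector with finitely many real coordinates is determined in law by its means and
covariances. -/
lemma ProbabilityTheory.HasGaussianLaw.map_eq_map_of_covariance {ι Ω Ω' : Type*}
    [Fintype ι] [MeasurableSpace Ω] [MeasurableSpace Ω'] {P : Measure Ω} {Q : Measure Ω'} [IsProbabilityMeasure P]
    [IsProbabilityMeasure Q] {X : Ω → ι → ℝ} {Y : Ω' → ι → ℝ}
    (hX : HasGaussianLaw X P) (hY : HasGaussianLaw Y Q)
    (hmean : ∀ i, ∫ ω, X ω i ∂P = ∫ ω, Y ω i ∂Q)
    (hcov : ∀ i j, cov[fun ω => X ω i, fun ω => X ω j; P] =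
      cov[fun ω => Y ω i, fun ω => Y ω j; Q]) :
    P.map X = Q.map Y := by
  classical
  have := Measure.isProbabilityMeasure_map (μ := P) hX.aemeasurable
  have := Measure.isProbabilityMeasure_map (μ := Q) hY.aemeasurable
  -- The characteristic function of a Gaussian law at `L` involves only the mean and variance of `L
  -- ∘ X`, which expand into coordinate means and covariances.
  refine Measure.ext_of_charFunDual ?_
  ext L
  have key (x : ι → ℝ) : L x = ∑ i, L (Pi.single i 1) * x i := by
    conv_lhs => rw [pi_eq_sum_univ' x]
    simp [map_sum, mul_comm]
  have hXi i : MemLp (fun ω => X ω i) 2 P := (hX.eval i).memLp_two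
  have hYi i : MemLp (fun ω => Y ω i) 2 Q := (hY.eval i).memLp_two
  rw [hX.charFunDual_map_eq_fun, hY.charFunDual_map_eq_fun]
  rw [show (fun ω => L (X ω)) = fun ω => ∑ i, L (Pi.single i 1) * X ω i from
      funext fun ω => key (X ω),
    show (fun ω => L (Y ω)) = fun ω => ∑ i, L (Pi.single i 1) * Y ω i from
      funext fun ω => key (Y ω),
    integral_finsetSum _ fun i _ => ((hXi i).integrable one_le_two).const_mul _,
    integral_finsetSum _ fun i _ => ((hYi i).integrable one_le_two).const_mul _,
    variance_fun_sum fun i => (hXi i).const_mul _, variance_fun_sum fun i => (hYi i).const_mul _]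
  simp_rw [integral_const_mul, covariance_const_mul_left, covariance_const_mul_right, hmean, hcov]

/-- The law of `n` independent standard Gaussian variables. -/
noncomputable def stdGaussianPi (n : ℕ) : Measure (Fin n → ℝ) :=
  Measure.pi fun _ => gaussianReal 0 1

instance (n : ℕ) : IsProbabilityMeasure (stdGaussianPi n) := by
  unfold stdGaussianPi; infer_instance

lemma stdGaussianPi_measurePreserving_eval {n : ℕ} (i : Fin n) :
    MeasurePreserving (fun x : Fin n → ℝ => x i) (stdGaussianPi n) (gaussianReal 0 1) :=
  measurePreserving_eval (fun _ : Fin n => gaussianReal 0 1) i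

instance (n : ℕ) : IsGaussian (stdGaussianPi n) := by
  have h : HasGaussianLaw (fun x : Fin n → ℝ => (x ·)) (stdGaussianPi n) := by
    refine iIndepFun.hasGaussianLaw (X := fun i (x : Fin n → ℝ) => x i) (fun i => ?_) ?_
    · refine ⟨?_⟩
      rw [(stdGaussianPi_measurePreserving_eval i).map_eq]
      infer_instance
    · exact iIndepFun_pi (X := fun _ => id) (fun _ => aemeasurable_id)
  have := h.isGaussian_map
  rwa [show (fun x : Fin n → ℝ => (x ·)) = id from rfl, Measure.map_id] at this

lemma covariance_eval_stdGaussianPi {n : ℕ} (i j : Fin n) :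
    cov[fun x => x i, fun x => x j; stdGaussianPi n] = if i = j then 1 else 0 := by
  have hp i := stdGaussianPi_measurePreserving_eval (n := n) i
  have hm i : MemLp (fun x : Fin n → ℝ => x i) 2 (stdGaussianPi n) :=
    (memLp_id_gaussianReal' 2 (by simp)).comp_measurePreserving (hp i)
  split_ifs with h
  · subst h
    rw [covariance_self (measurable_pi_apply i).aemeasurable]
    have := variance_id_map (μ := stdGaussianPi n) (hp i).measurable.aemeasurable
    rw [(hp i).map_eq, variance_id_gaussianReal] at this
    exact_mod_cast this.symm
  · have hI : iIndepFun (fun i (x : Fin n → ℝ) => x i) (stdGaussianPi n) :=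
      iIndepFun_pi (X := fun _ => id) (fun _ => aemeasurable_id)
    exact (hI.indepFun h).covariance_eq_zero (hm i) (hm j)

/-- The equicorrelated Gaussian vector with correlation `a ^ 2`, where `a ^ 2 + b ^ 2 = 1`, has the
law of `a * Z + b * ξ i`. -/
lemma ProbabilityTheory.HasGaussianLaw.map_eq_of_equicorrelated {n : ℕ} {Ω : Type*}
    [MeasurableSpace Ω]
    {P : Measure Ω} [IsProbabilityMeasure P] {X : Ω → Fin n → ℝ} (hX : HasGaussianLaw X P)
    (hmean : ∀ i, ∫ ω, X ω i ∂P = 0) {a b : ℝ}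
    (hcov : ∀ i j, cov[fun ω => X ω i, fun ω => X ω j; P] = a ^ 2 + if i = j then b ^ 2 else 0) :
    P.map X = ((gaussianReal 0 1).prod (stdGaussianPi n)).map (fun p i => a * p.1 + b * p.2 i) := by
  set ν := (gaussianReal 0 1).prod (stdGaussianPi n)
  let T : ℝ × (Fin n → ℝ) →L[ℝ] (Fin n → ℝ) :=
    ContinuousLinearMap.pi fun i => a • ContinuousLinearMap.fst ℝ ℝ (Fin n → ℝ) +
      b • (ContinuousLinearMap.proj i).comp (ContinuousLinearMap.snd ℝ ℝ (Fin n → ℝ))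
  have hY : HasGaussianLaw (fun (p : ℝ × (Fin n → ℝ)) i => a * p.1 + b * p.2 i) ν :=
    IsGaussian.hasGaussianLaw_id.map T
  have h1 : MeasurePreserving (Prod.fst : ℝ × (Fin n → ℝ) → ℝ) ν (gaussianReal 0 1) :=
    measurePreserving_fst
  have h2 : MeasurePreserving (Prod.snd : ℝ × (Fin n → ℝ) → _) ν (stdGaussianPi n) :=
    measurePreserving_snd
  have hp i := stdGaussianPi_measurePreserving_eval (n := n) i
  have hm1 : MemLp (fun p : ℝ × (Fin n → ℝ) => p.1) 2 ν :=
    (memLp_id_gaussianReal' 2 (by simp)).comp_measurePreserving h1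
  have hm2 i : MemLp (fun p : ℝ × (Fin n → ℝ) => p.2 i) 2 ν :=
    (memLp_id_gaussianReal' 2 (by simp)).comp_measurePreserving ((hp i).comp h2)
  have hind i : IndepFun (fun p : ℝ × (Fin n → ℝ) => p.1) (fun p => p.2 i) ν :=
    indepFun_prod (X := id) (Y := fun x : Fin n → ℝ => x i) measurable_id (measurable_pi_apply i)
  have hi1 : ∫ p, p.1 ∂ν = 0 := by
    have := integral_map (μ := ν) h1.measurable.aemeasurable
      (f := id) (by fun_prop)
    rw [h1.map_eq] at this
    simpa using this.symm
  have hi2 i : ∫ p, p.2 i ∂ν = 0 := by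
    have := integral_map (μ := ν) ((hp i).comp h2).measurable.aemeasurable
      (f := id) (by fun_prop)
    rw [((hp i).comp h2).map_eq] at this
    simpa using this.symm
  have hv1 : Var[fun p : ℝ × (Fin n → ℝ) => p.1; ν] = 1 := by
    have := variance_id_map (μ := ν) h1.measurable.aemeasurable
    rw [h1.map_eq, variance_id_gaussianReal] at this
    exact_mod_cast this.symm
  refine HasGaussianLaw.map_eq_map_of_covariance hX hY (fun i => ?_) fun i j => ?_
  · rw [hmean, integral_add ((hm1.integrable one_le_two).const_mul _)
      (((hm2 i).integrable one_le_two).const_mul _), integral_const_mul, integral_const_mul,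
      hi1, hi2]
    simp
  · have hc2 : cov[fun p : ℝ × (Fin n → ℝ) => p.2 i, fun p => p.2 j; ν] =
        if i = j then 1 else 0 := by
      rw [← covariance_eval_stdGaussianPi, ← h2.map_eq,
        covariance_map_fun (measurable_pi_apply i).aestronglyMeasurable
          (measurable_pi_apply j).aestronglyMeasurable h2.measurable.aemeasurable]
    have ha : MemLp (fun p : ℝ × (Fin n → ℝ) => a * p.1) 2 ν := hm1.const_mul a
    have hb i : MemLp (fun p : ℝ × (Fin n → ℝ) => b * p.2 i) 2 ν := (hm2 i).const_mul b
    have hadd := covariance_add_left ha (hb i) (ha.add (hb j))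
    rw [covariance_add_right ha ha (hb j), covariance_add_right (hb i) ha (hb j)] at hadd
    refine (hcov i j).trans (Eq.trans ?_ hadd.symm)
    simp_rw [covariance_const_mul_left, covariance_const_mul_right]
    rw [covariance_self (by fun_prop), hv1, hc2, (hind j).covariance_eq_zero hm1 (hm2 j),
      (hind i).symm.covariance_eq_zero (hm2 i) hm1]
    split_ifs <;> ring

/-! ### The maximum of finitely many coordinates -/

lemma le_maxCoord {n : ℕ} (x : Fin n → ℝ) (i : Fin n) : x i ≤ maxCoord x :=
  le_ciSup (Set.finite_range x).bddAbove i

lemma exists_eq_maxCoord {n : ℕ} [NeZero n] (x : Fin n → ℝ) : ∃ i, x i = maxCoord x :=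
  exists_eq_ciSup_of_finite

lemma measurable_maxCoord {n : ℕ} : Measurable (maxCoord (n := n)) :=
  Measurable.iSup fun i => measurable_pi_apply i

lemma maxCoord_add_mul {n : ℕ} [NeZero n] (c : ℝ) {b : ℝ} (hb : 0 ≤ b) (x : Fin n → ℝ) :
    maxCoord (fun i => c + b * x i) = c + b * maxCoord x := by
  obtain ⟨i, hi⟩ := exists_eq_maxCoord fun i => c + b * x i
  obtain ⟨j, hj⟩ := exists_eq_maxCoord x
  apply le_antisymm
  · rw [← hi]
    gcongr
    exact le_maxCoord x i
  · rw [← hj]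
    exact le_maxCoord (fun i => c + b * x i) j

lemma memLp_maxCoord_stdGaussianPi {n : ℕ} [NeZero n] :
    MemLp maxCoord 2 (stdGaussianPi n) := by
  refine (IsGaussian.memLp_two_id (μ := stdGaussianPi n)).of_le
    measurable_maxCoord.aestronglyMeasurable (ae_of_all _ fun x => ?_)
  obtain ⟨i, hi⟩ := exists_eq_maxCoord x
  rw [← hi]
  exact norm_le_pi_norm x i

/-! ### One-dimensional Gaussian estimates -/

lemma integral_sq_gaussianReal_zero_one : ∫ x, x ^ 2 ∂(gaussianReal 0 1) = 1 := by
  have h := variance_id_gaussianReal (μ := 0) (v := 1)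
  rw [variance_eq_integral (by fun_prop)] at h
  simpa using h

lemma integral_sub_sq_gaussianReal_zero_one (b : ℝ) :
    ∫ x, (x - b) ^ 2 ∂(gaussianReal 0 1) = 1 + b ^ 2 := by
  have h2 : Integrable (fun x : ℝ => x ^ 2) (gaussianReal 0 1) :=
    (memLp_id_gaussianReal' 2 (by simp)).integrable_sq
  have h1 : Integrable (fun x : ℝ => x) (gaussianReal 0 1) :=
    (memLp_id_gaussianReal' 1 (by simp)).integrable le_rfl
  calc _ = ∫ x, (x ^ 2 - 2 * b * x) + b ^ 2 ∂(gaussianReal 0 1) := by congr with x; ring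
    _ = _ := by
      have h3 : Integrable (fun x : ℝ => x ^ 2 - 2 * b * x) (gaussianReal 0 1) :=
        h2.sub (h1.const_mul _)
      rw [integral_add h3 (integrable_const _),
        integral_sub h2 (h1.const_mul _), integral_const_mul, integral_sq_gaussianReal_zero_one,
        integral_id_gaussianReal]
      simp

lemma max_sq_le_exp {s t : ℝ} (ht : 0 < t) : max s 0 ^ 2 ≤ 2 / t ^ 2 * Real.exp (t * s) := by
  rcases le_total s 0 with h | h
  · rw [max_eq_right h]
    simp only [ne_eq, OfNat.ofNat_ne_zero, not_false_eq_true, zero_pow]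
    positivity
  · rw [max_eq_left h, div_mul_eq_mul_div, le_div_iff₀ (by positivity)]
    have h1 := Real.quadratic_le_exp_of_nonneg (x := t * s) (by positivity)
    nlinarith [mul_nonneg ht.le h]

lemma integrable_max_sq_gaussianReal (b : ℝ) :
    Integrable (fun x : ℝ => max (x - b) 0 ^ 2) (gaussianReal 0 1) := by
  have h : MemLp (fun x : ℝ => x - b) 2 (gaussianReal 0 1) :=
    (memLp_id_gaussianReal' 2 (by simp)).sub (memLp_const b)
  exact h.pos_part.integrable_sq

/-- A Chernoff bound: dominate the squared excess by an exponential with tilt `b` and use the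
Gaussian moment generating function. -/
lemma integral_max_sq_gaussianReal_le {b : ℝ} (hb : 0 < b) :
    ∫ x, max (x - b) 0 ^ 2 ∂(gaussianReal 0 1) ≤ 2 / b ^ 2 * Real.exp (-(b ^ 2 / 2)) := by
  have hmgf := congrFun (mgf_id_gaussianReal (μ := 0) (v := 1)) b
  simp only [mgf, id_eq, NNReal.coe_one, zero_mul, zero_add, one_mul] at hmgf
  calc _ ≤ ∫ x, 2 / b ^ 2 * Real.exp (-b ^ 2) * Real.exp (b * x) ∂(gaussianReal 0 1) := by
        refine integral_mono (integrable_max_sq_gaussianReal b)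
          ((integrable_exp_mul_gaussianReal b).const_mul _) fun x => ?_
        refine (max_sq_le_exp hb).trans_eq ?_
        rw [mul_assoc, ← Real.exp_add]
        ring_nf
    _ = _ := by
        rw [integral_const_mul, hmgf, mul_assoc, ← Real.exp_add]
        ring_nf

/-- On `(b - ε, b - ε / 2]`, of length `ε / 2`, the density is at least its value at the right
endpoint. Stopping short of `b` gains a factor of order `exp (b * ε / 2)` over `exp (-b ^ 2 / 2)`.
-/
lemma gaussianReal_real_Ioi_ge {b ε : ℝ} (hε : 0 < ε) (hb : ε ≤ b) :
    ε / 2 * ((√(2 * Real.pi))⁻¹ * Real.exp (-(b - ε / 2) ^ 2 / 2)) ≤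
      (gaussianReal 0 1).real (Set.Ioi (b - ε)) := by
  calc _ = ∫ x in Set.Ioc (b - ε) (b - ε / 2),
        (√(2 * Real.pi))⁻¹ * Real.exp (-(b - ε / 2) ^ 2 / 2) := by
        rw [setIntegral_const, smul_eq_mul, Real.volume_real_Ioc_of_le (by linarith)]
        ring
    _ ≤ ∫ x in Set.Ioc (b - ε) (b - ε / 2), gaussianPDFReal 0 1 x := by
        refine setIntegral_mono_on (integrableOn_const measure_Ioc_lt_top.ne)
          (integrable_gaussianPDFReal 0 1).integrableOn
          measurableSet_Ioc fun x hx => ?_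
        simp only [gaussianPDFReal, NNReal.coe_one, mul_one, sub_zero]
        have : x ^ 2 ≤ (b - ε / 2) ^ 2 := by
          apply pow_le_pow_left₀ _ hx.2
          linarith [hx.1]
        gcongr
    _ = (gaussianReal 0 1).real (Set.Ioc (b - ε) (b - ε / 2)) := by
        rw [measureReal_def, gaussianReal_apply_eq_integral _ one_ne_zero, ENNReal.toReal_ofReal]
        exact integral_nonneg fun x => gaussianPDFReal_nonneg _ _ _
    _ ≤ _ := measureReal_mono fun x hx => hx.1

/-- The three terms cover a maximum above `b`, within `ε` below `b`, and below `b - ε`. In the last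
case `x 0 ≤ maxCoord x ≤ b` bounds the deviation by that of `x 0`; the indicators use only the other
coordinates, so the term factorizes under the product measure. -/
lemma sub_sq_maxCoord_le {m : ℕ} {b ε : ℝ} (hε : 0 < ε) (x : Fin (m + 1) → ℝ) :
    (maxCoord x - b) ^ 2 ≤ ∑ i, max (x i - b) 0 ^ 2 + ε ^ 2 +
      (x 0 - b) ^ 2 * ∏ i : Fin m, (Set.Iic (b - ε)).indicator 1 (x i.succ) := by
  have h1 : 0 ≤ ∑ i, max (x i - b) 0 ^ 2 := Finset.sum_nonneg fun i _ => sq_nonneg _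
  have h2 : 0 ≤ (x 0 - b) ^ 2 * ∏ i : Fin m, (Set.Iic (b - ε)).indicator (1 : ℝ → ℝ) (x i.succ) :=
    mul_nonneg (sq_nonneg _) (Finset.prod_nonneg fun i _ =>
      Set.indicator_nonneg (fun _ _ => zero_le_one) _)
  rcases le_total b (maxCoord x) with hM | hM
  · obtain ⟨i, hi⟩ := exists_eq_maxCoord x
    have := Finset.single_le_sum (f := fun i => max (x i - b) 0 ^ 2)
      (fun i _ => sq_nonneg _) (Finset.mem_univ i)
    simp only [hi] at this
    rw [max_eq_left (by linarith)] at this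
    nlinarith [sq_nonneg ε]
  · rcases le_total (b - ε) (maxCoord x) with hM' | hM'
    · nlinarith
    · have : ∏ i : Fin m, (Set.Iic (b - ε)).indicator (1 : ℝ → ℝ) (x i.succ) = 1 := by
        refine Finset.prod_eq_one fun i _ => ?_
        rw [Set.indicator_of_mem ((le_maxCoord x _).trans hM' : _ ∈ Set.Iic _)]
        rfl
      rw [this] at *
      nlinarith [le_maxCoord x 0, sq_nonneg ε]

lemma integral_sub_sq_maxCoord_le {m : ℕ} {b ε : ℝ} (hε : 0 < ε) (hb : 0 < b) :
    ∫ x, (maxCoord x - b) ^ 2 ∂(stdGaussianPi (m + 1)) ≤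
      (m + 1) * (2 / b ^ 2 * Real.exp (-(b ^ 2 / 2))) + ε ^ 2 +
      (1 + b ^ 2) * Real.exp (-(m * (gaussianReal 0 1).real (Set.Ioi (b - ε)))) := by
  have hp i := stdGaussianPi_measurePreserving_eval (n := m + 1) i
  have hI i : Integrable (fun x : Fin (m + 1) → ℝ => max (x i - b) 0 ^ 2)
      (stdGaussianPi (m + 1)) :=
    (hp i).integrable_comp_of_integrable (integrable_max_sq_gaussianReal b)
  have hS : Integrable (fun x : Fin (m + 1) → ℝ => ∑ i, max (x i - b) 0 ^ 2 + ε ^ 2)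
      (stdGaussianPi (m + 1)) :=
    (integrable_finsetSum _ fun i _ => hI i).add (integrable_const _)
  let f : Fin (m + 1) → ℝ → ℝ :=
    Fin.cons (fun x => (x - b) ^ 2) fun _ => (Set.Iic (b - ε)).indicator 1
  have hf (x : Fin (m + 1) → ℝ) : (x 0 - b) ^ 2 *
      ∏ i : Fin m, (Set.Iic (b - ε)).indicator 1 (x i.succ) = ∏ i, f i (x i) := by
    simp [f, Fin.prod_univ_succ]
  have hfI : Integrable (fun x : Fin (m + 1) → ℝ => ∏ i, f i (x i)) (stdGaussianPi (m + 1)) := by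
    refine Integrable.fintype_prod fun i => ?_
    refine Fin.cases ?_ (fun i => ?_) i
    · exact ((memLp_id_gaussianReal' 2 (by simp)).sub (memLp_const b)).integrable_sq
    · exact (integrable_const (1 : ℝ)).indicator measurableSet_Iic
  have hprod : ∫ x, ∏ i, f i (x i) ∂(stdGaussianPi (m + 1)) ≤
      (1 + b ^ 2) * Real.exp (-(m * (gaussianReal 0 1).real (Set.Ioi (b - ε)))) := by
    rw [stdGaussianPi, integral_fintype_prod_eq_prod, Fin.prod_univ_succ]
    simp only [f, Fin.cons_zero, Fin.cons_succ, Finset.prod_const, Finset.card_univ,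
      Fintype.card_fin, integral_sub_sq_gaussianReal_zero_one]
    rw [integral_indicator_one measurableSet_Iic, neg_mul_eq_mul_neg, Real.exp_nat_mul]
    gcongr
    rw [← Set.compl_Ioi, probReal_compl_eq_one_sub measurableSet_Ioi]
    -- `1 - p ≤ exp (-p)` for the probability that one coordinate stays below `b - ε`.
    linarith [Real.add_one_le_exp (-(gaussianReal 0 1).real (Set.Ioi (b - ε)))]
  calc _ ≤ ∫ x, (∑ i, max (x i - b) 0 ^ 2 + ε ^ 2 + ∏ i, f i (x i)) ∂(stdGaussianPi (m + 1)) := by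
        refine integral_mono (memLp_maxCoord_stdGaussianPi.sub (memLp_const b)).integrable_sq
          (hS.add hfI) fun x => ?_
        simp only [← hf]
        exact sub_sq_maxCoord_le hε x
    _ = (m + 1) * (∫ x, max (x - b) 0 ^ 2 ∂(gaussianReal 0 1)) + ε ^ 2 +
          ∫ x, ∏ i, f i (x i) ∂(stdGaussianPi (m + 1)) := by
        rw [integral_add hS hfI,
          integral_add (integrable_finsetSum _ fun i _ => hI i) (integrable_const _),
          integral_finsetSum _ fun i _ => hI i]
        have (i : Fin (m + 1)) : ∫ x, max (x i - b) 0 ^ 2 ∂(stdGaussianPi (m + 1)) =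
            ∫ x, max (x - b) 0 ^ 2 ∂(gaussianReal 0 1) := by
          rw [← (hp i).map_eq, integral_map (hp i).measurable.aemeasurable (by fun_prop)]
        simp [this]
    _ ≤ _ := by
        gcongr
        exact integral_max_sq_gaussianReal_le hb

/-! ### Asymptotics of the independent maximum -/

lemma tendsto_sqrt_two_log_atTop : Tendsto (fun n : ℕ => √(2 * Real.log n)) atTop atTop :=
  Real.tendsto_sqrt_atTop.comp
    ((Real.tendsto_log_atTop.comp tendsto_natCast_atTop_atTop).const_mul_atTop two_pos)

/-- This choice of `b` makes `exp (-b ^ 2 / 2)` equal to `1 / (m + 1)`, cancelling the number of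
coordinates. -/
lemma integral_sub_sq_maxCoord_le_of_log {m : ℕ} (hm : 1 ≤ m) {b ε : ℝ} (hε : 0 < ε) (hεb : ε ≤ b)
    (hb : b ^ 2 = 2 * Real.log (m + 1)) :
    ∫ x, (maxCoord x - b) ^ 2 ∂(stdGaussianPi (m + 1)) ≤ 2 / b ^ 2 + ε ^ 2 +
      (1 + b ^ 2) * Real.exp (-(ε ^ 2 / 8 * (√(2 * Real.pi))⁻¹ * Real.exp (-(ε ^ 2 / 8)) * b)) := by
  have hb0 : 0 < b := hε.trans_le hεb
  have hm1 : (1 : ℝ) ≤ m := by exact_mod_cast hm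
  have hexp : Real.exp (-(b ^ 2 / 2)) = ((m : ℝ) + 1)⁻¹ := by
    rw [hb, mul_div_cancel_left₀ _ two_ne_zero, Real.exp_neg, Real.exp_log (by positivity)]
  refine (integral_sub_sq_maxCoord_le hε hb0).trans ?_
  rw [hexp]
  gcongr ?_ + _ + _ * Real.exp (-?_)
  · apply le_of_eq
    field_simp
  · have h1 := gaussianReal_real_Ioi_ge hε hεb
    have h2 : Real.exp (-(b - ε / 2) ^ 2 / 2) =
        ((m : ℝ) + 1)⁻¹ * (Real.exp (b * ε / 2) * Real.exp (-(ε ^ 2 / 8))) := by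
      rw [← hexp, ← Real.exp_add, ← Real.exp_add]
      ring_nf
    -- A linear bound suffices: the resulting decay in `b` is exponential and beats `1 + b ^ 2`.
    have h3 : b * ε / 2 ≤ Real.exp (b * ε / 2) := by
      linarith [Real.add_one_le_exp (b * ε / 2)]
    have h4 : (1 : ℝ) / 2 ≤ m * ((m : ℝ) + 1)⁻¹ := by
      rw [← div_eq_mul_inv, div_le_div_iff₀ two_pos (by positivity)]
      linarith
    calc _ = 1 / 2 * (ε / 2 * ((√(2 * Real.pi))⁻¹ *
          (b * ε / 2 * Real.exp (-(ε ^ 2 / 8))))) := by ring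
      _ ≤ m * ((m : ℝ) + 1)⁻¹ * (ε / 2 * ((√(2 * Real.pi))⁻¹ *
          (Real.exp (b * ε / 2) * Real.exp (-(ε ^ 2 / 8))))) := by gcongr
      _ = m * (ε / 2 * ((√(2 * Real.pi))⁻¹ * Real.exp (-(b - ε / 2) ^ 2 / 2))) := by
        rw [h2]; ring
      _ ≤ _ := by gcongr

lemma tendsto_one_add_sq_mul_exp_neg {k : ℝ} (hk : 0 < k) :
    Tendsto (fun b : ℝ => (1 + b ^ 2) * Real.exp (-(k * b))) atTop (𝓝 0) := by
  have h : Tendsto (fun b : ℝ => k * b) atTop atTop := tendsto_id.const_mul_atTop hk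
  have h0 := (Real.tendsto_pow_mul_exp_neg_atTop_nhds_zero 0).comp h
  have h2 := ((Real.tendsto_pow_mul_exp_neg_atTop_nhds_zero 2).comp h).const_mul (k ^ 2)⁻¹
  refine (by simpa using h0.add h2 : Tendsto _ _ (𝓝 (0 : ℝ))).congr fun b => ?_
  field_simp

/-- The maximum of `n` independent standard Gaussian variables is `√(2 log n) + o(1)` in `L²`. -/
lemma tendsto_integral_sub_sq_maxCoord :
    Tendsto (fun n : ℕ => ∫ x, (maxCoord x - √(2 * Real.log n)) ^ 2 ∂(stdGaussianPi n))
      atTop (𝓝 0) := by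
  refine tendsto_order.2 ⟨fun δ hδ => Eventually.of_forall fun n =>
    hδ.trans_le (integral_nonneg fun _ => sq_nonneg _), fun δ hδ => ?_⟩
  -- Then the non-vanishing term `ε ^ 2` is `δ / 2`, below `δ`.
  set ε := √(δ / 2)
  have hε : 0 < ε := Real.sqrt_pos.2 (by positivity)
  have hε2 : ε ^ 2 = δ / 2 := Real.sq_sqrt (by positivity)
  have hk : 0 < ε ^ 2 / 8 * (√(2 * Real.pi))⁻¹ * Real.exp (-(ε ^ 2 / 8)) := by positivity
  have hlim : Tendsto (fun b : ℝ => 2 / b ^ 2 + ε ^ 2 + (1 + b ^ 2) *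
      Real.exp (-(ε ^ 2 / 8 * (√(2 * Real.pi))⁻¹ * Real.exp (-(ε ^ 2 / 8)) * b)))
      atTop (𝓝 (0 + ε ^ 2 + 0)) :=
    (((tendsto_pow_atTop two_ne_zero).const_div_atTop 2).add_const _).add
      (tendsto_one_add_sq_mul_exp_neg hk)
  have hlt : 0 + ε ^ 2 + 0 < δ := by linarith
  filter_upwards [tendsto_sqrt_two_log_atTop.eventually (hlim.eventually_lt_const hlt),
    tendsto_sqrt_two_log_atTop.eventually_ge_atTop ε, eventually_ge_atTop 2] with n h1 h2 hn
  obtain ⟨m, rfl⟩ : ∃ m, n = m + 1 := ⟨n - 1, by omega⟩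
  refine (integral_sub_sq_maxCoord_le_of_log (by omega) hε h2 ?_).trans_lt h1
  rw [Real.sq_sqrt (mul_nonneg two_pos.le (Real.log_natCast_nonneg _))]
  push_cast
  rfl

/-- Second moments of the maximum of an equicorrelated Gaussian vector. -/
lemma ProbabilityTheory.HasGaussianLaw.integral_sub_sq_maxCoord {n : ℕ} [NeZero n] {Ω : Type*}
    [MeasurableSpace Ω]
    {P : Measure Ω} [IsProbabilityMeasure P] {X : Ω → Fin n → ℝ} (hX : HasGaussianLaw X P)
    (hmean : ∀ i, ∫ ω, X ω i ∂P = 0) {a b : ℝ} (hb : 0 ≤ b)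
    (hcov : ∀ i j, cov[fun ω => X ω i, fun ω => X ω j; P] = a ^ 2 + if i = j then b ^ 2 else 0)
    (t : ℝ) :
    ∫ ω, (maxCoord (X ω) - b * t) ^ 2 ∂P =
      a ^ 2 + b ^ 2 * ∫ x, (maxCoord x - t) ^ 2 ∂(stdGaussianPi n) := by
  have hM : MemLp (fun x => maxCoord x - t) 2 (stdGaussianPi n) :=
    memLp_maxCoord_stdGaussianPi.sub (memLp_const t)
  have hZ : MemLp (fun z : ℝ => z) 2 (gaussianReal 0 1) := memLp_id_gaussianReal' 2 (by simp)
  have hm : AEStronglyMeasurable (fun x : Fin n → ℝ => (maxCoord x - b * t) ^ 2)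
      (P.map X) := ((measurable_maxCoord.sub_const _).pow_const 2).aestronglyMeasurable
  have hS : Measurable (fun (p : ℝ × (Fin n → ℝ)) i => a * p.1 + b * p.2 i) := by fun_prop
  rw [← integral_map hX.aemeasurable hm]
  rw [hX.map_eq_of_equicorrelated hmean hcov] at hm ⊢
  rw [integral_map hS.aemeasurable hm]
  have h1 : Integrable (fun p : ℝ × (Fin n → ℝ) => p.1 ^ 2 * 1)
      ((gaussianReal 0 1).prod (stdGaussianPi n)) := hZ.integrable_sq.mul_prod (integrable_const 1)
  have h2 : Integrable (fun p : ℝ × (Fin n → ℝ) => p.1 * (maxCoord p.2 - t))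
      ((gaussianReal 0 1).prod (stdGaussianPi n)) :=
    (hZ.integrable one_le_two).mul_prod (hM.integrable one_le_two)
  have h3 : Integrable (fun p : ℝ × (Fin n → ℝ) => 1 * (maxCoord p.2 - t) ^ 2)
      ((gaussianReal 0 1).prod (stdGaussianPi n)) :=
    (integrable_const (1 : ℝ)).mul_prod hM.integrable_sq
  have h12 : Integrable (fun p : ℝ × (Fin n → ℝ) =>
      a ^ 2 * (p.1 ^ 2 * 1) + 2 * a * b * (p.1 * (maxCoord p.2 - t)))
      ((gaussianReal 0 1).prod (stdGaussianPi n)) :=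
    (h1.const_mul (a ^ 2)).add (h2.const_mul (2 * a * b))
  calc _ = ∫ p, ((a ^ 2 * (p.1 ^ 2 * 1) + 2 * a * b * (p.1 * (maxCoord p.2 - t))) +
          b ^ 2 * (1 * (maxCoord p.2 - t) ^ 2)) ∂((gaussianReal 0 1).prod (stdGaussianPi n)) := by
        congr with p
        rw [maxCoord_add_mul _ hb]
        ring
    _ = _ := by
        rw [integral_add h12 (h3.const_mul _), integral_add (h1.const_mul _) (h2.const_mul _),
          integral_const_mul, integral_const_mul, integral_const_mul,
          integral_prod_mul (fun z : ℝ => z ^ 2) (fun _ : Fin n → ℝ => (1 : ℝ)),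
          integral_prod_mul (fun z : ℝ => z) (fun x : Fin n → ℝ => maxCoord x - t),
          integral_prod_mul (fun _ : ℝ => (1 : ℝ)) (fun x : Fin n → ℝ => (maxCoord x - t) ^ 2),
          integral_sq_gaussianReal_zero_one, integral_id_gaussianReal]
        simp

/-- A median is close to every point around which the variable has small second moment. -/
lemma IsMedian.abs_sub_le {Ω : Type*} [MeasurableSpace Ω] {P : Measure Ω} [IsFiniteMeasure P]
    {Y : Ω → ℝ} {m c K : ℝ} (h : IsMedian P Y m) (hY : MemLp Y 2 P) (hK : 0 < K)
    (hc : ∫ ω, (Y ω - c) ^ 2 ∂P < K ^ 2 / 2) : |m - c| ≤ K := by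
  have hmarkov := mul_meas_ge_le_integral_of_nonneg (μ := P) (f := fun ω => (Y ω - c) ^ 2)
    (ae_of_all _ fun _ => sq_nonneg _) (hY.sub (memLp_const c)).integrable_sq (K ^ 2)
  have hsmall : P.real {ω | K ^ 2 ≤ (Y ω - c) ^ 2} < 1 / 2 := by
    have := hmarkov.trans_lt hc
    have hK2 : 0 < K ^ 2 := by positivity
    nlinarith
  have half {s : Set Ω} (hs : 1 / 2 ≤ P s) : 1 / 2 ≤ P.real s := by
    have := ENNReal.toReal_mono (measure_ne_top P s) hs
    simpa [measureReal_def] using this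
  rw [abs_le]
  constructor <;> by_contra! hlt
  -- If `m` lies outside `[c - K, c + K]`, a half-line of probability at least `1 / 2` sits inside
  -- the deviation event.
  · have := (half h.1).trans (measureReal_mono (μ := P) (s₂ := {ω | K ^ 2 ≤ (Y ω - c) ^ 2})
      fun ω (hω : Y ω ≤ m) => show K ^ 2 ≤ (Y ω - c) ^ 2 by nlinarith)
    linarith
  · have := (half h.2).trans (measureReal_mono (μ := P) (s₂ := {ω | K ^ 2 ≤ (Y ω - c) ^ 2})
      fun ω (hω : m ≤ Y ω) => show K ^ 2 ≤ (Y ω - c) ^ 2 by nlinarith)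
    linarith

lemma ProbabilityTheory.HasGaussianLaw.memLp_maxCoord {n : ℕ} [NeZero n] {Ω : Type*}
    [MeasurableSpace Ω]
    {P : Measure Ω} {X : Ω → Fin n → ℝ} (hX : HasGaussianLaw X P) :
    MemLp (fun ω => maxCoord (X ω)) 2 P := by
  refine hX.memLp_two.of_le
    (measurable_maxCoord.comp_aemeasurable hX.aemeasurable).aestronglyMeasurable
    (ae_of_all _ fun ω => ?_)
  obtain ⟨i, hi⟩ := exists_eq_maxCoord (X ω)
  rw [← hi]
  exact norm_le_pi_norm (X ω) i

theorem proposition4p3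
    (ρ₀ : ℝ) (hρ₀ : 0 < ρ₀) (hρ₁ : ρ₀ < 1)
    (Ω : ℕ → Type*) [∀ n, MeasurableSpace (Ω n)]
    (P : ∀ n, Measure (Ω n)) [∀ n, IsProbabilityMeasure (P n)]
    (X : ∀ n, Ω n → Fin n → ℝ)
    (hX : ∀ n, HasGaussianLaw (X n) (P n))
    (hmean : ∀ n (i : Fin n), ∫ ω, X n ω i ∂(P n) = 0)
    (hvar : ∀ n (i : Fin n), Var[fun ω => X n ω i; P n] = 1)
    (hcorr : ∀ n (i j : Fin n), i ≠ j → corrMatrix (P n) (X n) i j = ρ₀)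
    (med : ℕ → ℝ)
    (hmed : ∀ n, IsMedian (P n) (fun ω => maxCoord (X n ω)) (med n)) :
    Tendsto
      (fun n : ℕ =>
        med n ^ 2 / Var[fun ω => maxCoord (X n ω); P n] * (1 / (2 * Real.log n)))
      atTop (𝓝 ((1 - ρ₀) / ρ₀)) := by
  set b := √(1 - ρ₀)
  have hb : 0 < b := Real.sqrt_pos.2 (by linarith)
  have hb2 : b ^ 2 = 1 - ρ₀ := Real.sq_sqrt (by linarith)
  have ha2 : √ρ₀ ^ 2 = ρ₀ := Real.sq_sqrt hρ₀.le
  have hcov n (i j : Fin n) : cov[fun ω => X n ω i, fun ω => X n ω j; P n] =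
      √ρ₀ ^ 2 + if i = j then b ^ 2 else 0 := by
    rw [ha2, hb2]
    split_ifs with h
    · subst h
      rw [covariance_self ((hX n).eval i).aemeasurable, hvar]
      ring
    · simpa [corrMatrix, hvar] using hcorr n i j h
  have hmoment n [NeZero n] (t : ℝ) : ∫ ω, (maxCoord (X n ω) - b * t) ^ 2 ∂(P n) =
      ρ₀ + (1 - ρ₀) * ∫ x, (maxCoord x - t) ^ 2 ∂(stdGaussianPi n) := by
    rw [(hX n).integral_sub_sq_maxCoord (hmean n) hb.le (hcov n), ha2, hb2]
  set t : ℕ → ℝ := fun n => √(2 * Real.log n)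
  set J : ℕ → ℝ := fun n => ∫ x, (maxCoord x - t n) ^ 2 ∂(stdGaussianPi n)
  have hJ : Tendsto J atTop (𝓝 0) := tendsto_integral_sub_sq_maxCoord
  have hV : Tendsto (fun n => Var[fun ω => maxCoord (X n ω); P n]) atTop (𝓝 ρ₀) := by
    refine tendsto_of_tendsto_of_tendsto_of_le_of_le' tendsto_const_nhds
      (by simpa using (hJ.const_mul (1 - ρ₀)).const_add ρ₀ :
        Tendsto (fun n => ρ₀ + (1 - ρ₀) * J n) atTop (𝓝 ρ₀)) ?_ ?_
    · filter_upwards [eventually_ge_atTop 1] with n hn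
      have : NeZero n := ⟨by omega⟩
      rw [variance_eq_integral (hX n).memLp_maxCoord.aemeasurable]
      -- With this `t`, the centre `b * t` is the mean, so the identity gives the variance exactly
      -- and bounds it below by `ρ₀`.
      have h := hmoment n (b⁻¹ * ∫ ω, maxCoord (X n ω) ∂(P n))
      rw [mul_inv_cancel_left₀ hb.ne'] at h
      rw [h]
      exact le_add_of_nonneg_right (mul_nonneg (by linarith) (integral_nonneg fun _ => sq_nonneg _))
    · filter_upwards [eventually_ge_atTop 1] with n hn
      have : NeZero n := ⟨by omega⟩
      have hY := (hX n).memLp_maxCoord.aestronglyMeasurable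
      rw [← hmoment n (t n), ← variance_sub_const hY (b * t n)]
      exact variance_le_expectation_sq (hY.sub aestronglyMeasurable_const)
  have ht : Tendsto t atTop atTop := tendsto_sqrt_two_log_atTop
  have hclose : ∀ᶠ n in atTop, |med n - b * t n| ≤ 2 := by
    filter_upwards [eventually_ge_atTop 1, hJ.eventually_lt_const one_pos] with n hn hJn
    have : NeZero n := ⟨by omega⟩
    -- `K = 2` works because the second moment is below `ρ₀ + (1 - ρ₀) = 1 < K ^ 2 / 2` once `J n <
    -- 1`.
    refine (hmed n).abs_sub_le (hX n).memLp_maxCoord two_pos ?_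
    rw [hmoment n (t n)]
    change ρ₀ + (1 - ρ₀) * J n < _
    nlinarith
  have hmedlim : Tendsto (fun n => med n / t n) atTop (𝓝 b) := by
    have h0 : Tendsto (fun n => (med n - b * t n) / t n) atTop (𝓝 0) := by
      refine squeeze_zero_norm' ?_ (ht.const_div_atTop 2)
      filter_upwards [hclose, ht.eventually_gt_atTop 0] with n hn htn
      rw [norm_div, Real.norm_eq_abs, Real.norm_of_nonneg htn.le]
      gcongr
    refine (by simpa using h0.add_const b : Tendsto _ _ (𝓝 b)).congr' ?_
    filter_upwards [ht.eventually_gt_atTop 0] with n htn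
    field_simp
    ring
  have hfinal := (hmedlim.pow 2).div hV hρ₀.ne'
  rw [hb2] at hfinal
  refine hfinal.congr fun n => ?_
  have : t n ^ 2 = 2 * Real.log n :=
    Real.sq_sqrt (mul_nonneg two_pos.le (Real.log_natCast_nonneg _))
  simp only [Pi.div_apply, div_pow, this]
  ring
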